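/- Let $(R,\mathfrak m)$ be a Gorenstein local ring, that is, a commutative Noetherian local ring of finite injective dimension as a module over itself. Let $I\subset R$ be a proper ideal such that $R/I$ is a Cohen–Macaulay local ring. Let $g=\operatorname{grade}(I)$ be the supremum of the lengths of the $R$-regular sequences contained in $I$. Let $\mathbf y=y_1,\dots,y_n$ ($n\ge 0$) be any finite sequence of generators of $I$, and let $H_i(\mathbf y)$ denote the $i$-th homology module of the Koszul complex of $\mathbf y$ with coefficients in $R$, with $H_i(\mathbf y)=0$ for $i<0$. Then there is an isomorphism of $R$-modules $$H_{n-g-1}(\mathbf y)\;\cong\;\operatorname{Ext}^{g}_R\bigl(H_1(\mathbf y),R\bigr).$$ -/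

import Mathlib

open CategoryTheory

universe u

namespace KoszulExt

section Rings

/-- The grade of an ideal `I` on the ring itself: the supremum of the lengths of the
`R`-regular sequences contained in `I`. -/
noncomputable def grade {R : Type u} [CommRing R] (I : Ideal R) : ℕ∞ :=
  ⨆ (rs : List R) (_ : RingTheory.Sequence.IsRegular R rs) (_ : ∀ r ∈ rs, r ∈ I),
    (rs.length : ℕ∞)

/-- A Gorenstein local ring: a Noetherian local ring of finite injective dimension
as a module over itself. -/
structure IsGorensteinLocalRing (R : Type u) [CommRing R] : Prop where
  isLocalRing : IsLocalRing R
  isNoetherianRing : IsNoetherianRing R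
  injectiveDimension_ne_top : injectiveDimension (ModuleCat.of R R) ≠ ⊤

/-- A Cohen–Macaulay local ring: a Noetherian local ring whose depth (the grade of its maximal
ideal) equals its Krull dimension. -/
structure IsCohenMacaulayLocalRing (A : Type u) [CommRing A] : Prop where
  isLocalRing : IsLocalRing A
  isNoetherianRing : IsNoetherianRing A
  depth_eq_dim : (grade (IsLocalRing.maximalIdeal A) : WithBot ℕ∞) = ringKrullDim A

/-- An ideal `I` of a local ring `R` is Cohen–Macaulay if `R ⧸ I` is a Cohen–Macaulay local ring;
in particular `I` is then a proper ideal. -/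
def IsCohenMacaulayIdeal {R : Type u} [CommRing R] (I : Ideal R) : Prop :=
  IsCohenMacaulayLocalRing (R ⧸ I)

end Rings

section Koszul

variable {R : Type u} [CommRing R] {n : ℕ}

/-- Contraction of the exterior algebra of `Rⁿ` with a linear form lowers the degree by one. -/
theorem contractLeft_mem (f : Module.Dual R (Fin n → R)) (p : ℕ) (x : ExteriorAlgebra R (Fin n → R))
    (hx : x ∈ ⋀[R]^(p + 1) (Fin n → R)) :
    CliffordAlgebra.contractLeft (Q := (0 : QuadraticForm R (Fin n → R))) f x
      ∈ ⋀[R]^p (Fin n → R) := by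
  induction p generalizing x with
  | zero =>
    rw [ExteriorAlgebra.exteriorPower, zero_add, pow_one] at hx
    obtain ⟨v, rfl⟩ := hx
    rw [ExteriorAlgebra.exteriorPower, pow_zero]
    erw [CliffordAlgebra.contractLeft_ι]
    exact Submodule.algebraMap_mem _
  | succ p ih =>
    rw [ExteriorAlgebra.exteriorPower, pow_succ'] at hx
    induction hx using Submodule.mul_induction_on' with
    | mem_mul_mem a ha b hb =>
      obtain ⟨v, rfl⟩ := ha
      erw [CliffordAlgebra.contractLeft_ι_mul]
      refine Submodule.sub_mem _ (Submodule.smul_mem _ _ hb) ?_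
      rw [ExteriorAlgebra.exteriorPower, pow_succ']
      exact Submodule.mul_mem_mul ⟨v, rfl⟩ (ih b hb)
    | add a _ b _ ha hb =>
      rw [map_add]
      exact Submodule.add_mem _ ha hb

/-- The Koszul differential `⋀ᵖ⁺¹ Rⁿ → ⋀ᵖ Rⁿ` of `y₁, …, yₙ`: contraction with the linear form
`eᵢ ↦ yᵢ`, that is,
`e_{i₀} ∧ ⋯ ∧ e_{iₚ} ↦ ∑ₖ (-1)ᵏ y_{iₖ} e_{i₀} ∧ ⋯ (omit e_{iₖ}) ⋯ ∧ e_{iₚ}`. -/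
noncomputable def koszulD (y : Fin n → R) (p : ℕ) :
    ⋀[R]^(p + 1) (Fin n → R) →ₗ[R] ⋀[R]^p (Fin n → R) :=
  LinearMap.restrict
    (CliffordAlgebra.contractLeft (Q := (0 : QuadraticForm R (Fin n → R)))
      (Fintype.linearCombination R y))
    (contractLeft_mem (Fintype.linearCombination R y) p)

theorem koszulD_comp (y : Fin n → R) (p : ℕ) : koszulD y p ∘ₗ koszulD y (p + 1) = 0 := by
  refine LinearMap.ext fun x => ?_
  exact Subtype.ext (CliffordAlgebra.contractLeft_contractLeft _ _)

/-- The Koszul complex `K(y₁, …, yₙ; R)`. -/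
noncomputable def koszulComplex (y : Fin n → R) : ChainComplex (ModuleCat.{u} R) ℕ :=
  ChainComplex.of (fun p => ModuleCat.of R (⋀[R]^p (Fin n → R)))
    (fun p => ModuleCat.ofHom (koszulD y p))
    (fun p => by rw [← ModuleCat.ofHom_comp, koszulD_comp]; rfl)

/-- The Koszul homology module `H_i(y₁, …, yₙ)` for an integer `i`; it is zero for `i < 0`. -/
noncomputable def koszulHomology (y : Fin n → R) : ℤ → ModuleCat.{u} R
  | Int.ofNat i => (koszulComplex y).homology i
  | Int.negSucc _ => ModuleCat.of R PUnit

end Koszul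

end KoszulExt

section

open Abelian RingTheory.Sequence

/-! ### Vanishing of Ext along short exact sequences -/

section LongExactSequence

universe v w

variable {C : Type u} [Category.{v} C] [Abelian C] [HasExt.{w} C] {S : ShortComplex C}

/-! The Koszul complex K is self-dual: wedging into ⋀ⁿ identifies H_{n-g-1}(y) with the cohomology
of Hom(K, R) in degree g + 1 (`wedgePairing_bijective`, `wedgePairing_koszulD`). That cohomology is
the abutment of the spectral sequence Ext^p(H_q(y), R) ⇒ H^{p+q}(Hom(K, R)). In total degree g + 1
the terms with q ≥ 2 have p < g and vanish, because I kills H_q(y) and contains a regular sequence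
of length g. The term with q = 0, and the target of the differential leaving Ext^g(H_1(y), R),
vanish because Ext^i(R/I, R) = 0 for i > g. Only Ext^g(H_1(y), R) survives.
`ChainComplex.exists_surjective_to_ext_homology` makes this argument by dimension shifting along the
quotients K_i/B_i, without a spectral sequence.

The vanishing for i > g (`extVanishes_quotient_of_grade_lt`) is where the Gorenstein and
Cohen–Macaulay hypotheses enter. Put e = depth R and t = depth R/I = dim R/I. Finite injective
dimension gives Ext^i(M, R) = 0 for finite M and i > e, and cutting R/I by a regular sequence of
length t improves this to i > e - t. Ischebeck's theorem kills Ext^i(R/I, R) for i < e - t, while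
Rees' theorem finds a nonzero one in some degree at most g; hence e - t ≤ g. -/

theorem CategoryTheory.ShortComplex.ShortExact.subsingleton_ext_X₂ (hS : S.ShortExact) (Y : C)
    (i : ℕ) (h₁ : Subsingleton (Ext S.X₁ Y i)) (h₃ : Subsingleton (Ext S.X₃ Y i)) :
    Subsingleton (Ext S.X₂ Y i) := by
  refine subsingleton_of_forall_eq 0 fun x => ?_
  obtain ⟨z, rfl⟩ := Ext.contravariant_sequence_exact₂ hS Y x (Subsingleton.elim _ _)
  rw [Subsingleton.elim z 0, Ext.comp_zero]

theorem CategoryTheory.ShortComplex.ShortExact.subsingleton_ext_X₃ (hS : S.ShortExact) (Y : C)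
    (i : ℕ) (h₁ : Subsingleton (Ext S.X₁ Y i)) (h₂ : Subsingleton (Ext S.X₂ Y (i + 1))) :
    Subsingleton (Ext S.X₃ Y (i + 1)) := by
  refine subsingleton_of_forall_eq 0 fun x => ?_
  obtain ⟨z, rfl⟩ := Ext.contravariant_sequence_exact₃ hS Y x (Subsingleton.elim _ _)
    (add_comm 1 i)
  rw [Subsingleton.elim z 0, Ext.comp_zero]

theorem CategoryTheory.ShortComplex.ShortExact.subsingleton_ext_X₁ (hS : S.ShortExact) (Y : C)
    (i : ℕ) (h₂ : Subsingleton (Ext S.X₂ Y i)) (h₃ : Subsingleton (Ext S.X₃ Y (i + 1))) :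
    Subsingleton (Ext S.X₁ Y i) := by
  refine subsingleton_of_forall_eq 0 fun x => ?_
  obtain ⟨z, rfl⟩ := Ext.contravariant_sequence_exact₁ hS Y x (add_comm 1 i)
    (Subsingleton.elim _ _)
  rw [Subsingleton.elim z 0, Ext.comp_zero]

theorem CategoryTheory.Iso.subsingleton_ext {X X' : C} (e : X ≅ X') (Y : C) (i : ℕ)
    (h : Subsingleton (Ext X Y i)) : Subsingleton (Ext X' Y i) := by
  refine subsingleton_of_forall_eq 0 fun x => ?_
  have : (Ext.mk₀ e.inv).comp ((Ext.mk₀ e.hom).comp x (zero_add i)) (zero_add i) = x := by simp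
  rw [← this, Subsingleton.elim ((Ext.mk₀ e.hom).comp x (zero_add i)) 0, Ext.comp_zero]

theorem CategoryTheory.Abelian.Ext.mk₀_smul_id_comp {R : Type*} [Ring R] [Linear R C] {X Y : C}
    {i : ℕ} (r : R) (e : Ext X Y i) : (Ext.mk₀ (r • 𝟙 X)).comp e (zero_add i) = r • e := by
  rw [Ext.mk₀_smul, Ext.smul_comp, Ext.mk₀_id_comp]

theorem CategoryTheory.Abelian.Ext.comp_mk₀_smul_id {R : Type*} [Ring R] [Linear R C] {X Y : C}
    {i : ℕ} (r : R) (e : Ext X Y i) : e.comp (Ext.mk₀ (r • 𝟙 Y)) (add_zero i) = r • e := by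
  rw [Ext.mk₀_smul, Ext.comp_smul, Ext.comp_mk₀_id]

end LongExactSequence

variable {R : Type u} [CommRing R]

/-- `Ext^i_R(M, Y) = 0`, with `M` unbundled. -/
abbrev ExtVanishes (M : Type u) [AddCommGroup M] [Module R M] (Y : ModuleCat.{u} R) (i : ℕ) :
    Prop :=
  Subsingleton (Ext.{u} (ModuleCat.of R M) Y i)

/-! ### Nakayama, dévissage and Ischebeck's theorem -/

section Modules

variable {M N P : Type u} [AddCommGroup M] [Module R M] [AddCommGroup N] [Module R N]
  [AddCommGroup P] [Module R P] {Y : ModuleCat.{u} R}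

theorem shortExact_of_exact {f : M →ₗ[R] N} {g : N →ₗ[R] P} (hf : Function.Injective f)
    (hg : Function.Surjective g) (h : Function.Exact f g) :
    (ModuleCat.shortComplexOfCompEqZero f g h.linearMap_comp_eq_zero).ShortExact where
  exact := ModuleCat.shortComplex_exact _ h
  mono_f := (ModuleCat.mono_iff_injective _).2 hf
  epi_g := (ModuleCat.epi_iff_surjective _).2 hg

theorem LinearEquiv.extVanishes (e : M ≃ₗ[R] N) {i : ℕ} (h : ExtVanishes M Y i) :
    ExtVanishes N Y i :=
  e.toModuleIso.subsingleton_ext Y i h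

theorem extVanishes_of_subsingleton [Subsingleton M] (i : ℕ) : ExtVanishes M Y i := by
  refine subsingleton_of_forall_eq 0 fun x => ?_
  have : 𝟙 (ModuleCat.of R M) = 0 := by
    ext x
    exact Subsingleton.elim (α := M) _ _
  rw [← Ext.mk₀_id_comp x, this, Ext.mk₀_zero, Ext.zero_comp]

/-- Nakayama's lemma for `Ext`. -/
theorem extVanishes_of_quotSMulTop [IsLocalRing R] [IsNoetherianRing R] [Module.Finite R M]
    [Module.Finite R Y] {x : R} (hx : x ∈ IsLocalRing.maximalIdeal R) (hreg : IsSMulRegular M x)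
    {i : ℕ} (h : ExtVanishes (QuotSMulTop x M) Y (i + 1)) : ExtVanishes M Y i := by
  have hS := IsSMulRegular.smulShortComplex_shortExact (M := ModuleCat.of R M) hreg
  have : Module.Finite R (ModuleCat.of R M) := ‹Module.Finite R M›
  have hfin : Module.Finite R (Ext.{u} (ModuleCat.of R M) Y i) := ModuleCat.finite_ext R _ _ i
  suffices (⊤ : Submodule R (Ext.{u} (ModuleCat.of R M) Y i)) = ⊥ from
    (Submodule.subsingleton_iff R).1 ((subsingleton_iff_bot_eq_top).1 this.symm)
  -- The connecting map out of Ext^i(M, Y) lands in Ext^{i+1}(M/xM, Y) = 0, so multiplication by x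
  -- is surjective on the finite module Ext^i(M, Y).
  refine Submodule.eq_bot_of_le_smul_of_le_jacobson_bot (Ideal.span {x}) _ hfin.fg_top ?_ ?_
  · intro e _
    obtain ⟨e', rfl⟩ := Ext.contravariant_sequence_exact₁ hS Y e (add_comm 1 i)
      (@Subsingleton.elim _ h _ _)
    have : (Ext.mk₀ ((ModuleCat.of R M).smulShortComplex x).f).comp e' (zero_add i) = x • e' :=
      Ext.mk₀_smul_id_comp x e'
    rw [this]
    exact Submodule.smul_mem_smul (Ideal.mem_span_singleton_self x) trivial
  · rw [IsLocalRing.jacobson_eq_maximalIdeal _ bot_ne_top, Ideal.span_singleton_le_iff_mem]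
    exact hx

/-- Dévissage: `Ext` into `Y` vanishes on a finite module as soon as it vanishes on the prime
cyclic modules over its annihilator. -/
theorem extVanishes_of_primes [IsNoetherianRing R] [hM : Module.Finite R M] {J : Ideal R}
    {i : ℕ} (h : ∀ p : Ideal R, p.IsPrime → J ≤ p → ExtVanishes (R ⧸ p) Y i)
    (hJ : J ≤ Module.annihilator R M) : ExtVanishes M Y i := by
  induction hM using IsNoetherianRing.induction_on_isQuotientEquivQuotientPrime R with
  | subsingleton N => exact extVanishes_of_subsingleton i
  | quotient N p e =>
    refine e.symm.extVanishes (h p.1 p.2 ?_)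
    rwa [e.annihilator_eq, Ideal.annihilator_quotient] at hJ
  | exact N₁ N₂ N₃ f g hf hg hfg h₁ h₃ =>
    exact (shortExact_of_exact hf hg hfg).subsingleton_ext_X₂ Y i
      (h₁ (hJ.trans (f.annihilator_le_of_injective hf)))
      (h₃ (hJ.trans (g.annihilator_le_of_surjective hg)))

/-- Vanishing of `Ext` propagates from the residue field to the cyclic modules `R ⧸ P`, with a
shift of the degree for each proper inclusion of primes. -/
theorem extVanishes_quotient_prime [IsLocalRing R] [IsNoetherianRing R] [Module.Finite R Y]
    (Q : ℕ → Ideal R → Prop)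
    (hQ : ∀ i (P p : Ideal R), P.IsPrime → p.IsPrime → P < p → Q i P → Q (i + 1) p)
    (h : ∀ i, Q i (IsLocalRing.maximalIdeal R) →
      ExtVanishes (R ⧸ IsLocalRing.maximalIdeal R) Y i)
    (P : Ideal R) (hP : P.IsPrime) (i : ℕ) (hi : Q i P) : ExtVanishes (R ⧸ P) Y i := by
  induction P using WellFoundedGT.induction generalizing i with
  | ind P ih =>
  by_cases hPm : P = IsLocalRing.maximalIdeal R
  · subst hPm
    exact h i hi
  obtain ⟨x, hxm, hxP⟩ := SetLike.exists_of_lt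
    (lt_of_le_of_ne (IsLocalRing.le_maximalIdeal hP.ne_top) hPm)
  have hreg : IsSMulRegular (R ⧸ P) x := by
    rw [isSMulRegular_iff_right_eq_zero_of_smul]
    intro y hy
    obtain ⟨y, rfl⟩ := Ideal.Quotient.mk_surjective y
    have hxy : Ideal.Quotient.mk P (x * y) = 0 := hy
    rw [Ideal.Quotient.eq_zero_iff_mem] at hxy ⊢
    exact (hP.mem_or_mem hxy).resolve_left hxP
  -- The quotient of R/P by x is killed by P + (x), so every prime in its dévissage strictly
  -- contains P and the induction hypothesis applies, one degree higher.
  refine extVanishes_of_quotSMulTop hxm hreg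
    (extVanishes_of_primes (J := P ⊔ Ideal.span {x}) (fun p hp hJp => ?_) (sup_le ?_ ?_))
  · have hlt : P < p := lt_of_le_of_ne (le_sup_left.trans hJp) fun hPp => hxP
      (hPp ▸ hJp (Ideal.mem_sup_right (Ideal.mem_span_singleton_self x)))
    exact ih p hlt hp _ (hQ i P p hP hp hlt hi)
  · refine (Ideal.annihilator_quotient (I := P)).ge.trans ?_
    exact LinearMap.annihilator_le_of_surjective (Submodule.mkQ _) (Submodule.mkQ_surjective _)
  · rw [Ideal.span_singleton_le_iff_mem, Module.mem_annihilator]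
    intro m
    obtain ⟨m, rfl⟩ := Submodule.mkQ_surjective _ m
    rw [← map_smul, Submodule.mkQ_apply, Submodule.Quotient.mk_eq_zero]
    exact Submodule.smul_mem_pointwise_smul m x ⊤ trivial

theorem extVanishes_of_residueField [IsLocalRing R] [IsNoetherianRing R] [Module.Finite R Y]
    [Module.Finite R M] {r : ℕ}
    (h : ∀ i, r ≤ i → ExtVanishes (R ⧸ IsLocalRing.maximalIdeal R) Y i) {i : ℕ} (hi : r ≤ i) :
    ExtVanishes M Y i :=
  extVanishes_of_primes (J := ⊥) (fun p hp _ => extVanishes_quotient_prime (fun i _ => r ≤ i)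
    (fun i _ _ _ _ _ h => h.trans i.le_succ) h p hp i hi) bot_le

theorem ringKrullDim_quotient_add_one_le {P p : Ideal R} (hP : P.IsPrime) (hlt : P < p) :
    ringKrullDim (R ⧸ p) + 1 ≤ ringKrullDim (R ⧸ P) := by
  obtain ⟨x, hxp, hxP⟩ := SetLike.exists_of_lt hlt
  refine ringKrullDim_succ_le_of_surjective (Ideal.Quotient.factor hlt.le)
    (Ideal.Quotient.factor_surjective hlt.le) (r := Ideal.Quotient.mk P x) ?_ ?_
  · exact mem_nonZeroDivisors_of_ne_zero (by rwa [Ne, Ideal.Quotient.eq_zero_iff_mem])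
  · rwa [Ideal.Quotient.factor_mk, Ideal.Quotient.eq_zero_iff_mem]

/-- Ischebeck's vanishing theorem for cyclic modules. -/
theorem extVanishes_of_add_ringKrullDim_lt [IsLocalRing R] [IsNoetherianRing R]
    [Module.Finite R Y] {e : ℕ}
    (h : ∀ i, i < e → ExtVanishes (R ⧸ IsLocalRing.maximalIdeal R) Y i) (I : Ideal R) {i : ℕ}
    (hi : ringKrullDim (R ⧸ I) + i < e) : ExtVanishes (R ⧸ I) Y i := by
  -- The condition dim R/P + i < e survives the shift: for a strictly larger prime the dimension
  -- drops by at least one while the degree rises by one.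
  refine extVanishes_of_primes (J := I) (fun p hp hIp => extVanishes_quotient_prime
    (fun i P => ringKrullDim (R ⧸ P) + i < e) ?_ ?_ p hp i ?_) Ideal.annihilator_quotient.ge
  · intro i P p hP _ hlt hlt'
    refine lt_of_le_of_lt ?_ hlt'
    rw [Nat.cast_add, Nat.cast_one, add_comm (i : WithBot ℕ∞), ← add_assoc]
    gcongr
    exact ringKrullDim_quotient_add_one_le hP hlt
  · intro i hi
    refine h i ?_
    have : ringKrullDim (R ⧸ IsLocalRing.maximalIdeal R) = 0 := by
      let : Field (R ⧸ IsLocalRing.maximalIdeal R) := Ideal.Quotient.field _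
      exact ringKrullDim_eq_zero_of_field _
    rw [this, zero_add] at hi
    exact_mod_cast hi
  · refine lt_of_le_of_lt ?_ hi
    gcongr
    exact ringKrullDim_le_of_surjective _ (Ideal.Quotient.factor_surjective hIp)

end Modules

end

section

open Abelian RingTheory.Sequence

/-! ### Regular sequences and Ext -/

section Depth

variable {R : Type u} [CommRing R]

/-- Easy half of Rees' theorem. -/
theorem subsingleton_ext_of_isWeaklyRegular (M : ModuleCat.{u} R) (rs : List R)
    (hM : ∀ r ∈ rs, r ∈ Module.annihilator R M) (N : Type u) [AddCommGroup N] [Module R N]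
    (hrs : IsWeaklyRegular N rs) {i : ℕ} (hi : i < rs.length) :
    Subsingleton (Ext.{u} M (ModuleCat.of R N) i) := by
  induction rs generalizing N i with
  | nil => simp at hi
  | cons x rs ih =>
    rw [isWeaklyRegular_cons_iff] at hrs
    have hS := IsSMulRegular.smulShortComplex_shortExact (M := ModuleCat.of R N) hrs.1
    refine subsingleton_of_forall_eq 0 fun e => ?_
    -- Multiplication by x on Ext can be computed through either argument, and x acts as zero on M.
    have hxe : e.comp (Ext.mk₀ ((ModuleCat.of R N).smulShortComplex x).f) (add_zero i) = 0 := by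
      refine (Ext.comp_mk₀_smul_id x e).trans ?_
      rw [← Ext.mk₀_smul_id_comp x e, ← ModuleCat.lsmul_eq_smul_id,
        Module.mem_annihilator_iff_lsmul_eq_zero.mp (hM x (by simp)), ModuleCat.ofHom_zero,
        Ext.mk₀_zero, Ext.zero_comp]
      rfl
    cases i with
    | zero =>
      have := hS.mono_f
      exact Ext.postcomp_mk₀_injective_of_mono M ((ModuleCat.of R N).smulShortComplex x).f
        (hxe.trans (Ext.zero_comp _ _ _ _ (add_zero 0)).symm)
    | succ i =>
      obtain ⟨z, rfl⟩ := Ext.covariant_sequence_exact₁ M hS e hxe rfl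
      have := ih (fun r hr => hM r (by simp [hr])) (QuotSMulTop x N) hrs.2 (i := i)
        (by simpa using hi)
      rw [show z = 0 from Subsingleton.elim (α := Ext.{u} M (ModuleCat.of R _) i) _ _,
        Ext.zero_comp]
      rfl

/-- Prime avoidance: the zero divisors on N form the union of its finitely many associated primes.
-/
theorem exists_isAssociatedPrime_of_not_isSMulRegular [IsNoetherianRing R] {N : Type u}
    [AddCommGroup N] [Module R N] [Module.Finite R N] {J : Ideal R}
    (h : ∀ x ∈ J, ¬ IsSMulRegular N x) : ∃ P, IsAssociatedPrime P N ∧ J ≤ P := by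
  have hJ : (J : Set R) ⊆ ⋃ p ∈ associatedPrimes R N, id p := by
    simp only [id]
    rw [biUnion_associatedPrimes_eq_zero_divisors]
    intro x hx
    have := h x hx
    rw [isSMulRegular_iff_right_eq_zero_of_smul] at this
    push Not at this
    obtain ⟨y, hy, hy'⟩ := this
    exact ⟨y, hy', hy⟩
  obtain ⟨P, hP, hJP⟩ := (J.subset_union_prime_finite (associatedPrimes.finite R N) (f := id) 0 0
    fun _ h _ _ => h.isPrime).1 hJ
  exact ⟨P, hP, hJP⟩

/-- Hard half of Rees' theorem: a maximal regular sequence on `N` in `J` detects a nonzero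
`Ext^i(R ⧸ J, N)`. -/
theorem exists_not_subsingleton_ext [IsNoetherianRing R] {J : Ideal R} (rs : List R)
    (N : Type u) [AddCommGroup N] [Module R N] [Module.Finite R N] (hrs : IsWeaklyRegular N rs)
    (hmax : ∀ x ∈ J, ¬ IsWeaklyRegular N (rs ++ [x])) :
    ∃ i ≤ rs.length, ¬ Subsingleton (Ext.{u} (ModuleCat.of R (R ⧸ J)) (ModuleCat.of R N) i) := by
  induction rs generalizing N with
  | nil =>
    simp only [List.nil_append, isWeaklyRegular_singleton_iff] at hmax
    obtain ⟨P, hP, hJP⟩ := exists_isAssociatedPrime_of_not_isSMulRegular hmax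
    obtain ⟨_, f, hf⟩ := (isAssociatedPrime_iff_exists_injective_linearMap P N).1 hP
    refine ⟨0, le_rfl, fun hsub => ?_⟩
    -- If Hom(R/J, N) were zero, so would be R/J → R/P ↪ N, which forces 1 ∈ P.
    have h0 := (Ext.mk₀_eq_zero_iff (ModuleCat.ofHom (f ∘ₗ Submodule.factor hJP))).1
      (Subsingleton.elim _ _)
    have h1 : (f ∘ₗ Submodule.factor hJP) (Ideal.Quotient.mk J 1) = 0 :=
      congrArg (fun φ => φ.hom (Ideal.Quotient.mk J 1)) h0
    have h2 : Ideal.Quotient.mk P 1 = 0 := hf (h1.trans (map_zero f).symm)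
    exact hP.isPrime.one_notMem (Ideal.Quotient.eq_zero_iff_mem.1 h2)
  | cons x rs ih =>
    rw [isWeaklyRegular_cons_iff] at hrs
    obtain ⟨i, hi, hne⟩ := ih (QuotSMulTop x N) hrs.2 fun y hy h =>
      hmax y hy ((isWeaklyRegular_cons_iff N x _).2 ⟨hrs.1, h⟩)
    have hS := IsSMulRegular.smulShortComplex_shortExact (M := ModuleCat.of R N) hrs.1
    by_contra! hcon
    refine hne (subsingleton_of_forall_eq 0 fun e => ?_)
    have h0 := hcon i (by simp; lia)
    have h1 := hcon (i + 1) (by simpa using hi)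
    obtain ⟨z, rfl⟩ := Ext.covariant_sequence_exact₃ _ hS e rfl
      (Subsingleton.elim (α := Ext.{u} (ModuleCat.of R (R ⧸ J)) (ModuleCat.of R N) (i + 1)) _ _)
    rw [show z = 0 from
      Subsingleton.elim (α := Ext.{u} (ModuleCat.of R (R ⧸ J)) (ModuleCat.of R N) i) _ _,
      Ext.zero_comp]
    rfl

/-- By Nakayama, each element of a regular sequence on M lowers the vanishing bound e by one. -/
theorem extVanishes_of_add_length_gt [IsLocalRing R] [IsNoetherianRing R] {Y : ModuleCat.{u} R}
    [Module.Finite R Y] {e : ℕ}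
    (he : ∀ (M : Type u) [AddCommGroup M] [Module R M] [Module.Finite R M] (i : ℕ),
      e < i → ExtVanishes M Y i) (rs : List R) (hm : ∀ r ∈ rs, r ∈ IsLocalRing.maximalIdeal R)
    (M : Type u) [AddCommGroup M] [Module R M] [Module.Finite R M] (hrs : IsWeaklyRegular M rs)
    {i : ℕ} (hi : e < i + rs.length) : ExtVanishes M Y i := by
  induction rs generalizing M i with
  | nil => exact he M i (by simpa using hi)
  | cons x rs ih =>
    rw [isWeaklyRegular_cons_iff] at hrs
    exact extVanishes_of_quotSMulTop (hm x (by simp)) hrs.1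
      (ih (fun r hr => hm r (by simp [hr])) _ hrs.2 (by simp at hi; lia))

/-- The residue field embeds into the quotient of `N` by a maximal regular sequence, whose `Ext`
vanishing range is shifted by the length of the sequence. -/
theorem exists_injective_of_maximal [IsLocalRing R] [IsNoetherianRing R] {Y : ModuleCat.{u} R}
    (rs : List R) (N : Type u) [AddCommGroup N] [Module R N] [Module.Finite R N]
    (hrs : IsWeaklyRegular N rs)
    (hmax : ∀ x ∈ IsLocalRing.maximalIdeal R, ¬ IsWeaklyRegular N (rs ++ [x])) {c : ℕ}
    (hN : ∀ i, c < i → ExtVanishes N Y i) :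
    ∃ (N' : Type u) (_ : AddCommGroup N') (_ : Module R N') (_ : Module.Finite R N')
      (f : R ⧸ IsLocalRing.maximalIdeal R →ₗ[R] N'), Function.Injective f ∧
      ∀ i, c + rs.length < i → ExtVanishes N' Y i := by
  induction rs generalizing N c with
  | nil =>
    simp only [List.nil_append, isWeaklyRegular_singleton_iff] at hmax
    obtain ⟨P, hP, hJP⟩ := exists_isAssociatedPrime_of_not_isSMulRegular hmax
    obtain rfl := (IsLocalRing.maximalIdeal.isMaximal R).eq_of_le hP.isPrime.ne_top hJP
    obtain ⟨_, f, hf⟩ := (isAssociatedPrime_iff_exists_injective_linearMap _ N).1 hP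
    exact ⟨N, _, _, ‹_›, f, hf, hN⟩
  | cons x rs ih =>
    rw [isWeaklyRegular_cons_iff] at hrs
    have hS := IsSMulRegular.smulShortComplex_shortExact (M := ModuleCat.of R N) hrs.1
    obtain ⟨N', _, _, _, f, hf, hN'⟩ := ih (QuotSMulTop x N) hrs.2 (fun y hy h =>
      hmax y hy ((isWeaklyRegular_cons_iff N x _).2 ⟨hrs.1, h⟩)) (c := c + 1) fun i hi => by
        cases i with
        | zero => simp at hi
        | succ i => exact hS.subsingleton_ext_X₃ Y i (hN i (by lia)) (hN (i + 1) (by lia))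
    exact ⟨N', _, _, ‹_›, f, hf, fun i hi => hN' i (by simp at hi; lia)⟩

open KoszulExt

/-- Inside the maximal ideal weakly regular sequences are regular, so they are all counted by the
grade. A finite supremum is attained, and a sequence attaining it cannot be extended within J. -/
theorem exists_maximal_isWeaklyRegular [IsLocalRing R] [IsNoetherianRing R] {J : Ideal R}
    (hJ : J ≤ IsLocalRing.maximalIdeal R) {e : ℕ} (he : grade J = e) :
    ∃ rs : List R, rs.length = e ∧ (∀ r ∈ rs, r ∈ J) ∧ IsWeaklyRegular R rs ∧
      ∀ x ∈ J, ¬ IsWeaklyRegular R (rs ++ [x]) := by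
  have hle : ∀ rs : List R, IsWeaklyRegular R rs → (∀ r ∈ rs, r ∈ J) → rs.length ≤ e := by
    intro rs hrs hrJ
    have hrs' := (IsLocalRing.isRegular_iff_isWeaklyRegular_of_subset_maximalIdeal
      fun r hr => hJ (hrJ r hr)).2 hrs
    have : (rs.length : ℕ∞) ≤ grade J :=
      le_iSup_of_le rs (le_iSup_of_le hrs' (le_iSup_of_le hrJ le_rfl))
    rw [he] at this
    exact_mod_cast this
  obtain ⟨rs, hrs, hrJ, hlen⟩ : ∃ rs : List R, IsWeaklyRegular R rs ∧ (∀ r ∈ rs, r ∈ J) ∧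
      e ≤ rs.length := by
    by_contra! hcon
    have hpos : 0 < e := Nat.pos_of_ne_zero fun h0 => by
      simpa [h0] using hcon [] (IsWeaklyRegular.nil R R) (by simp)
    have : grade J ≤ ((e - 1 : ℕ) : ℕ∞) := by
      refine iSup_le fun rs => iSup_le fun hrs => iSup_le fun hrJ => ?_
      have := hcon rs hrs.toIsWeaklyRegular hrJ
      exact_mod_cast (by lia : rs.length ≤ e - 1)
    rw [he] at this
    have : e ≤ e - 1 := by exact_mod_cast this
    lia
  refine ⟨rs, (hle rs hrs hrJ).antisymm hlen, hrJ, hrs, fun x hx h => ?_⟩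
  have := hle _ h (by simpa [or_imp, forall_and] using ⟨hrJ, hx⟩)
  simp at this
  lia

/-- Each term of a regular sequence lowers the dimension by exactly one, and the final quotient is
nonzero. This is what makes grades finite. -/
theorem grade_le_ringKrullDim [IsLocalRing R] [IsNoetherianRing R] (J : Ideal R) :
    (grade J : WithBot ℕ∞) ≤ ringKrullDim R := by
  obtain ⟨d, hd⟩ : ∃ d : ℕ, ringKrullDim R = d := ⟨_, Order.krullDim_eq_length_of_finiteDimensionalOrder⟩
  rw [hd]
  refine WithBot.coe_le_coe.2 (iSup_le fun rs => iSup_le fun hrs => iSup_le fun _ => ?_)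
  have := ringKrullDim_add_length_eq_ringKrullDim_of_isRegular rs hrs
  have hnt : Nontrivial (R ⧸ Ideal.ofList rs) := by
    have := hrs.quot_ofList_smul_nontrivial ⊤
    simpa using this
  have h0 : (0 : WithBot ℕ∞) ≤ ringKrullDim (R ⧸ Ideal.ofList rs) := ringKrullDim_nonneg_of_nontrivial
  have h1 : ((rs.length : ℕ) : WithBot ℕ∞) ≤ d := by
    rw [← hd, ← this]
    exact le_add_of_nonneg_left h0
  exact_mod_cast h1

end Depth

end

section

open Abelian RingTheory.Sequence

/-! ### Ext into a Gorenstein local ring -/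

section Gorenstein

open KoszulExt

variable {R : Type u} [CommRing R]

theorem exists_grade_eq_natCast [IsLocalRing R] [IsNoetherianRing R] (J : Ideal R) :
    ∃ e : ℕ, grade J = e := by
  have h := (grade_le_ringKrullDim J).trans_lt ringKrullDim_lt_top
  exact ENat.ne_top_iff_exists.1 (fun h' => by simp [h'] at h) |>.imp fun _ h => h.symm

/-- The self-injective dimension of a Gorenstein local ring is at most its depth. -/
theorem IsGorensteinLocalRing.extVanishes_of_depth_lt (hR : IsGorensteinLocalRing R)
    [IsLocalRing R] {e : ℕ} (he : grade (IsLocalRing.maximalIdeal R) = e)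
    (M : Type u) [AddCommGroup M] [Module R M] [Module.Finite R M] (i : ℕ) (hi : e < i) :
    ExtVanishes M (ModuleCat.of R R) i := by
  have := hR.isNoetherianRing
  have hYfin : Module.Finite R (ModuleCat.of R R) := inferInstanceAs (Module.Finite R R)
  obtain ⟨c, hc⟩ := (injectiveDimension_ne_top_iff _).1 hR.injectiveDimension_ne_top
  let k := R ⧸ IsLocalRing.maximalIdeal R
  have hex : ∃ r, ∀ i, r ≤ i → ExtVanishes k (ModuleCat.of R R) i :=
    ⟨c + 1, fun i hi => HasInjectiveDimensionLT.subsingleton.{u} (ModuleCat.of R R) (c + 1) i hi _⟩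
  classical
  refine extVanishes_of_residueField (Nat.find_spec hex) (?_ : Nat.find hex ≤ i)
  by_contra! hlt
  -- With r the least bound for the residue field k, suppose r > i > e. Embed k in a finite N with
  -- Ext^j(N, R) = 0 for j > e; then Ext^{r-1}(k, R) lies between Ext^{r-1}(N, R) = 0 and Ext^r(N/k,
  -- R) = 0, so r - 1 is also a bound.
  refine Nat.find_min hex (m := Nat.find hex - 1) (by lia) fun s hs => ?_
  obtain rfl | hs := hs.eq_or_lt'
  swap
  · exact Nat.find_spec hex s (by lia)
  obtain ⟨rs, hlen, -, hrs, hmax⟩ := exists_maximal_isWeaklyRegular le_rfl he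
  obtain ⟨N, _, _, _, f, hf, hN⟩ := exists_injective_of_maximal (Y := ModuleCat.of R R) rs R hrs
    hmax (c := 0) fun i hi => by
      obtain ⟨i, rfl⟩ := Nat.exists_eq_succ_of_ne_zero hi.ne'
      exact HasProjectiveDimensionLT.subsingleton.{u} (ModuleCat.of R R) 1 (i + 1) (by lia) _
  exact (shortExact_of_exact hf (Submodule.mkQ_surjective f.range)
    (LinearMap.exact_map_mkQ_range f)).subsingleton_ext_X₁ _ _ (hN _ (by lia))
    (extVanishes_of_residueField (M := N ⧸ f.range) (Nat.find_spec hex) (by lia))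

theorem extVanishes_quotient_of_grade_lt (hR : IsGorensteinLocalRing R) {I : Ideal R}
    (hI : IsCohenMacaulayIdeal I) {g : ℕ} (hg : grade I = g) {i : ℕ} (hi : g < i) :
    ExtVanishes (R ⧸ I) (ModuleCat.of R R) i := by
  have := hR.isLocalRing
  have := hR.isNoetherianRing
  have := hI.isLocalRing
  have := hI.isNoetherianRing
  have hYfin : Module.Finite R (ModuleCat.of R R) := inferInstanceAs (Module.Finite R R)
  have hIm : I ≤ IsLocalRing.maximalIdeal R :=
    IsLocalRing.le_maximalIdeal (Ideal.Quotient.nontrivial_iff.1 inferInstance)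
  obtain ⟨e, he⟩ := exists_grade_eq_natCast (IsLocalRing.maximalIdeal R)
  obtain ⟨t, ht⟩ := exists_grade_eq_natCast (IsLocalRing.maximalIdeal (R ⧸ I))
  have hdim : ringKrullDim (R ⧸ I) = t := by rw [← hI.depth_eq_dim, ht]; rfl
  have hvan := IsGorensteinLocalRing.extVanishes_of_depth_lt hR he
  obtain ⟨rs, hlen, hrsm, hrs, -⟩ := exists_maximal_isWeaklyRegular le_rfl ht
  obtain ⟨rs, rfl⟩ := List.map_surjective_iff.2 (Ideal.Quotient.mk_surjective (I := I)) rs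
  rw [← Ideal.Quotient.algebraMap_eq, isWeaklyRegular_map_algebraMap_iff] at hrs
  obtain ⟨ms, hmlen, hmm, hms, -⟩ := exists_maximal_isWeaklyRegular le_rfl he
  obtain ⟨xs, hxlen, -, hxs, hxmax⟩ := exists_maximal_isWeaklyRegular hIm hg
  obtain ⟨j, hj, hne⟩ := exists_not_subsingleton_ext xs R hxs hxmax
  -- Otherwise dim R/I + j < e and Ischebeck's theorem contradicts the nonvanishing in degree j ≤ g.
  have hej : e ≤ t + j := by
    by_contra! hcon
    refine hne (extVanishes_of_add_ringKrullDim_lt (e := e) (fun i hi => ?_) I ?_)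
    · refine subsingleton_ext_of_isWeaklyRegular _ ms ?_ R hms (hmlen ▸ hi)
      intro r hr
      exact (Ideal.annihilator_quotient (I := IsLocalRing.maximalIdeal R)).ge (hmm r hr)
    · rw [hdim]
      exact_mod_cast hcon
  refine extVanishes_of_add_length_gt hvan rs (fun r hr => ?_) _ hrs (i := i) ?_
  · have hr' := hrsm _ (List.mem_map_of_mem hr)
    rw [IsLocalRing.mem_maximalIdeal, mem_nonunits_iff] at hr' ⊢
    exact fun hu => hr' (hu.map _)
  · simp at hlen
    lia

theorem subsingleton_ext_of_lt_grade [IsLocalRing R] [IsNoetherianRing R] {I : Ideal R}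
    (hIm : I ≤ IsLocalRing.maximalIdeal R) {g : ℕ} (hg : grade I = g) (M : ModuleCat.{u} R)
    (hM : I ≤ Module.annihilator R M) {i : ℕ} (hi : i < g) :
    Subsingleton (Ext.{u} M (ModuleCat.of R R) i) := by
  obtain ⟨xs, hxlen, hxI, hxs, -⟩ := exists_maximal_isWeaklyRegular hIm hg
  exact subsingleton_ext_of_isWeaklyRegular M xs (fun r hr => hM (hxI r hr)) R hxs (hxlen ▸ hi)

end Gorenstein

end

section

open Abelian

/-! ### Cohomology of Hom(K, Y) by dimension shifting -/

section ChainComplexExt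

open Limits

universe v w t

variable {C : Type u} [Category.{v} C] [Abelian C]
  (R : Type t) [CommRing R] [Linear R C]

section

variable [HasExt.{w} C]

/-- The map `Ext^i(g, Y)` is bijective for an epimorphism `g` whose kernel has no `Ext` into `Y`
in degrees `i - 1` and `i`. -/
theorem CategoryTheory.ShortComplex.ShortExact.bijective_precomp_g {S : ShortComplex C}
    (hS : S.ShortExact) (Y : C) (i : ℕ) (h : Subsingleton (Ext S.X₁ Y i))
    (h' : ∀ j, j + 1 = i → Subsingleton (Ext S.X₁ Y j)) :
    Function.Bijective ((Ext.mk₀ S.g).precompOfLinear R Y (zero_add i)) := by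
  constructor
  · cases i with
    | zero =>
      have := hS.epi_g
      exact Ext.precomp_mk₀_injective_of_epi Y S.g
    | succ i =>
      rw [injective_iff_map_eq_zero]
      intro x hx
      obtain ⟨z, rfl⟩ := Ext.contravariant_sequence_exact₃ hS Y x hx (add_comm 1 i)
      have := h' i rfl
      rw [Subsingleton.elim z 0, Ext.comp_zero]
  · intro x
    exact Ext.contravariant_sequence_exact₂ hS Y x (Subsingleton.elim _ _)

theorem CategoryTheory.ShortComplex.ShortExact.bijective_precomp_f {S : ShortComplex C}
    (hS : S.ShortExact) (Y : C) (i : ℕ) (h : Subsingleton (Ext S.X₃ Y i))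
    (h' : Subsingleton (Ext S.X₃ Y (i + 1))) :
    Function.Bijective ((Ext.mk₀ S.f).precompOfLinear R Y (zero_add i)) := by
  constructor
  · rw [injective_iff_map_eq_zero]
    intro x hx
    obtain ⟨z, rfl⟩ := Ext.contravariant_sequence_exact₂ hS Y x hx
    rw [Subsingleton.elim z 0, Ext.comp_zero]
  · intro x
    exact Ext.contravariant_sequence_exact₁ hS Y x (add_comm 1 i) (Subsingleton.elim _ _)

theorem CategoryTheory.ShortComplex.ShortExact.bijective_precomp_extClass {S : ShortComplex C}
    (hS : S.ShortExact) (Y : C) (i : ℕ) (h : Subsingleton (Ext S.X₂ Y i))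
    (h' : Subsingleton (Ext S.X₂ Y (i + 1))) :
    Function.Bijective (hS.extClass.precompOfLinear R Y (add_comm 1 i)) := by
  constructor
  · rw [injective_iff_map_eq_zero]
    intro x hx
    obtain ⟨z, rfl⟩ := Ext.contravariant_sequence_exact₁ hS Y x (add_comm 1 i) hx
    rw [Subsingleton.elim z 0, Ext.comp_zero]
  · intro x
    exact Ext.contravariant_sequence_exact₃ hS Y x (Subsingleton.elim _ _) (add_comm 1 i)

end

namespace ChainComplex

variable (K : ChainComplex C ℕ)

/-- The short complex `Bᵢ → Kᵢ → Kᵢ/Bᵢ`. -/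
noncomputable abbrev boundariesShortComplex (i : ℕ) : ShortComplex C :=
  ShortComplex.mk (kernel.ι (K.pOpcycles i)) (K.pOpcycles i) (kernel.condition _)

theorem boundariesShortComplex_shortExact (i : ℕ) : (K.boundariesShortComplex i).ShortExact where
  exact := ShortComplex.exact_of_f_is_kernel _ (kernelIsKernel _)

theorem fromOpcycles_pOpcycles (i : ℕ) : K.fromOpcycles (i + 1) i ≫ K.pOpcycles i = 0 := by
  rw [← cancel_epi (K.pOpcycles (i + 1)), HomologicalComplex.p_fromOpcycles_assoc, comp_zero,
    HomologicalComplex.d_pOpcycles]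

/-- The short complex `Hᵢ₊₁ → Kᵢ₊₁/Bᵢ₊₁ → Bᵢ`. -/
noncomputable abbrev homologyShortComplex (i : ℕ) : ShortComplex C :=
  ShortComplex.mk (K.homologyι (i + 1))
    (kernel.lift (K.pOpcycles i) (K.fromOpcycles (i + 1) i) (K.fromOpcycles_pOpcycles i)) (by
      rw [← cancel_mono (kernel.ι _), Category.assoc, kernel.lift_ι,
        HomologicalComplex.homologyι_comp_fromOpcycles, zero_comp])

/-- The homology is the kernel of K_{i+1}/B_{i+1} → K_i, and this map has image B_i because K_{i+1}
already surjects onto B_i. -/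
theorem homologyShortComplex_shortExact (i : ℕ) : (K.homologyShortComplex i).ShortExact where
  exact := by
    have h := ShortComplex.exact_of_f_is_kernel (ShortComplex.mk _ _
      (K.homologyι_comp_fromOpcycles (i + 1) i)) (K.homologyIsKernel (i + 1) i (by simp))
    refine (ShortComplex.exact_iff_of_epi_of_isIso_of_mono (S₁ := K.homologyShortComplex i)
      (S₂ := ShortComplex.mk _ _ (K.homologyι_comp_fromOpcycles (i + 1) i))
      { τ₁ := 𝟙 _, τ₂ := 𝟙 _, τ₃ := kernel.ι _ }).2 h
  epi_g := by
    have h := (ShortComplex.exact_of_g_is_cokernel (ShortComplex.mk _ _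
      (K.d_pOpcycles (i + 1) i)) (K.opcyclesIsCokernel (i + 1) i (by simp))).epi_kernelLift
    refine @epi_of_epi_fac _ _ _ _ _ (K.pOpcycles (i + 1)) _ _ h ?_
    rw [← cancel_mono (kernel.ι _), Category.assoc]
    dsimp
    rw [kernel.lift_ι, kernel.lift_ι, HomologicalComplex.p_fromOpcycles]

variable {K}

/-- For a chain complex of `Ext(-, Y)`-acyclic objects with vanishing of `Ext^p(H_q, Y)` for
`p < g` and of `Ext^p(H_0, Y)` for `p = g + 1, g + 2`, the cohomology of `Hom(K, Y)` in degree
`g + 1` is `Ext^g(H_1, Y)`. -/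
theorem exists_surjective_to_ext_homology [HasExt.{w} C] (Y : C) (g : ℕ)
    (hK : ∀ i j, Subsingleton (Ext (K.X i) Y (j + 1)))
    (hH : ∀ i p, p < g → Subsingleton (Ext (K.homology (i + 1)) Y p))
    (h₁ : Subsingleton (Ext (K.opcycles 0) Y (g + 1)))
    (h₂ : Subsingleton (Ext (K.opcycles 0) Y (g + 2))) :
    ∃ θ : Ext (K.opcycles (g + 1)) Y 0 →ₗ[R] Ext (K.homology 1) Y g, Function.Surjective θ ∧
      ∀ x, θ x = 0 ↔ ∃ z : Ext (K.X g) Y 0,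
        (Ext.mk₀ (K.fromOpcycles (g + 1) g)).comp z (zero_add 0) = x := by
  have hfrom (i : ℕ) (z : Ext (K.X i) Y 0) :
      (Ext.mk₀ (K.fromOpcycles (i + 1) i)).comp z (zero_add 0) =
      (Ext.mk₀ (K.homologyShortComplex i).g).comp
        ((Ext.mk₀ (K.boundariesShortComplex i).f).comp z (zero_add 0)) (zero_add 0) := by
    rw [Ext.mk₀_comp_mk₀_assoc]
    simp
  -- Here K_0/B_0 is H_0, so vanishing on H_0 passes to B_0 one degree lower.
  have hB (p : ℕ) (h : Subsingleton (Ext (K.opcycles 0) Y (p + 2))) :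
      Subsingleton (Ext (K.homologyShortComplex 0).X₃ Y (p + 1)) :=
    (K.boundariesShortComplex_shortExact 0).subsingleton_ext_X₁ Y (p + 1) (hK 0 p) h
  cases g with
  | zero =>
    refine ⟨(Ext.mk₀ (K.homologyι 1)).precompOfLinear R Y (zero_add 0), fun x => ?_, fun x => ?_⟩
    · have := hB 0 h₂
      exact Ext.contravariant_sequence_exact₁ (K.homologyShortComplex_shortExact 0) Y x
        (add_comm 1 0) (Subsingleton.elim _ _)
    · constructor
      · intro hx
        obtain ⟨b, rfl⟩ := Ext.contravariant_sequence_exact₂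
          (K.homologyShortComplex_shortExact 0) Y x hx
        obtain ⟨z, rfl⟩ := Ext.contravariant_sequence_exact₁
          (K.boundariesShortComplex_shortExact 0) Y b (add_comm 1 0)
          (@Subsingleton.elim _ h₁ _ _)
        exact ⟨z, hfrom 0 z⟩
      · rintro ⟨z, rfl⟩
        change (Ext.mk₀ _).comp ((Ext.mk₀ _).comp z (zero_add 0)) (zero_add 0) = 0
        rw [Ext.mk₀_comp_mk₀_assoc, HomologicalComplex.homologyι_comp_fromOpcycles, Ext.mk₀_zero,
          Ext.zero_comp]
  | succ m =>
    -- One shift is Ext^{j+1}(K_{a+2}/B_{a+2}) ≅ Ext^{j+1}(B_{a+1}) ≅ Ext^{j+2}(K_{a+1}/B_{a+1}).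
    -- The first map needs Ext(H_{a+2}, Y) to vanish in degrees j and j + 1, both below g; the
    -- second needs K_{a+1} acyclic.
    have hshift (j a : ℕ) (hja : j + a = m) :
        Nonempty (Ext (K.opcycles (m + 1)) Y 1 ≃ₗ[R] Ext (K.opcycles (a + 1)) Y (j + 1)) := by
      induction j generalizing a with
      | zero =>
        obtain rfl : a = m := by lia
        exact ⟨LinearEquiv.refl _ _⟩
      | succ j ih =>
        obtain ⟨e⟩ := ih (a + 1) (by lia)
        refine ⟨e ≪≫ₗ (LinearEquiv.ofBijective _
          ((K.homologyShortComplex_shortExact (a + 1)).bijective_precomp_g R Y (j + 1)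
            (hH _ _ (by lia)) fun j' hj' => hH _ _ (by lia))).symm ≪≫ₗ
          LinearEquiv.ofBijective _
          ((K.boundariesShortComplex_shortExact (a + 1)).bijective_precomp_extClass R Y (j + 1)
            (hK _ _) (hK _ _))⟩
    obtain ⟨e⟩ := hshift m 0 (add_zero m)
    let e₀ := LinearEquiv.ofBijective _
      ((K.homologyShortComplex_shortExact (m + 1)).bijective_precomp_g R Y 0
        (hH _ _ (by lia)) (by simp))
    let e₁ := LinearEquiv.ofBijective _
      ((K.homologyShortComplex_shortExact 0).bijective_precomp_f R Y (m + 1) (hB _ h₁) (hB _ h₂))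
    have hS := K.boundariesShortComplex_shortExact (m + 1)
    -- With g = m + 1, θ is Hom(K_{g+1}/B_{g+1}, Y) ≅ Hom(B_g, Y) → Ext^1(K_g/B_g, Y) ≅
    -- Ext^g(K_1/B_1, Y) ≅ Ext^g(H_1, Y). The connecting map is surjective, and its kernel consists
    -- of the maps extending to K_g.
    refine ⟨(e ≪≫ₗ e₁).toLinearMap ∘ₗ hS.extClass.precompOfLinear R Y (add_zero 1) ∘ₗ
      e₀.symm.toLinearMap, ?_, fun x => ?_⟩
    · have hsurj : Function.Surjective (hS.extClass.precompOfLinear R Y (add_zero 1)) := fun x =>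
        Ext.contravariant_sequence_exact₃ hS Y x (@Subsingleton.elim _ (hK _ _) _ _) (add_zero 1)
      exact (e ≪≫ₗ e₁).surjective.comp (hsurj.comp e₀.symm.surjective)
    · obtain ⟨b, rfl⟩ := e₀.surjective x
      have : (∃ z : Ext (K.X (m + 1)) Y 0,
          (Ext.mk₀ (K.fromOpcycles (m + 1 + 1) (m + 1))).comp z (zero_add 0) = e₀ b) ↔
          ∃ z : Ext (K.X (m + 1)) Y 0,
            (Ext.mk₀ (K.boundariesShortComplex (m + 1)).f).comp z (zero_add 0) = b := by
        refine exists_congr fun z => ?_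
        rw [hfrom]
        exact e₀.injective.eq_iff (a := (Ext.mk₀ _).comp z _)
      rw [this]
      simp only [LinearMap.comp_apply, LinearEquiv.coe_coe, LinearEquiv.symm_apply_apply,
        LinearEquiv.map_eq_zero_iff]
      refine ⟨fun h => Ext.contravariant_sequence_exact₁ hS Y b (add_zero 1) h, ?_⟩
      rintro ⟨z, rfl⟩
      exact hS.extClass_comp_assoc z (h := add_zero 1)

end ChainComplex

end ChainComplexExt

end

/-! ### Self-duality of the exterior powers and the Koszul differential -/

section ExteriorDuality

open Module KoszulExt ExteriorAlgebra

variable {R : Type u} [CommRing R] {n : ℕ}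

theorem CliffordAlgebra.contractLeft_mul_of_mem_exteriorPower {M : Type*} [AddCommGroup M]
    [Module R M] (f : Module.Dual R M) (p : ℕ) (x z : ExteriorAlgebra R M) (hx : x ∈ ⋀[R]^p M) :
    contractLeft (Q := (0 : QuadraticForm R M)) f (x * z) =
      contractLeft (Q := (0 : QuadraticForm R M)) f x * z +
        (-1 : R) ^ p • (x * contractLeft (Q := (0 : QuadraticForm R M)) f z) := by
  induction p generalizing x with
  | zero =>
    rw [ExteriorAlgebra.exteriorPower, pow_zero] at hx
    obtain ⟨r, rfl⟩ := Submodule.mem_one.1 hx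
    erw [contractLeft_algebraMap_mul, contractLeft_algebraMap]
    rw [zero_mul, zero_add, pow_zero, one_smul]
  | succ p ih =>
    rw [ExteriorAlgebra.exteriorPower, pow_succ'] at hx
    induction hx using Submodule.mul_induction_on' with
    | mem_mul_mem a ha b hb =>
      obtain ⟨v, rfl⟩ := ha
      have h₁ := contractLeft_ι_mul (Q := (0 : QuadraticForm R M)) f v (b * z)
      have h₂ := contractLeft_ι_mul (Q := (0 : QuadraticForm R M)) f v b
      rw [ih b hb] at h₁
      rw [mul_assoc]
      refine h₁.trans ?_
      refine Eq.trans ?_ (congrArg (fun t => t * z + _) h₂.symm)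
      rw [mul_add, sub_mul, smul_mul_assoc, mul_assoc, mul_smul_comm, pow_succ, mul_neg_one,
        neg_smul, mul_assoc]
      abel
    | add a _ b _ ha hb =>
      simp only [add_mul, map_add, ha, hb, smul_add]
      abel

theorem exteriorPower_subsingleton_of_lt {p : ℕ} (h : n < p) :
    Subsingleton (⋀[R]^p (Fin n → R)) := by
  have : IsEmpty (Set.powersetCard (Fin n) p) := by
    refine ⟨fun s => ?_⟩
    have := s.1.card_le_univ
    rw [s.2, Fintype.card_fin] at this
    lia
  exact ((Pi.basisFun R (Fin n)).exteriorPower p).repr.toEquiv.subsingleton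

/-- The wedge pairing `⋀^q × ⋀^p → ⋀^n`, followed by the coordinate at `e₁ ∧ ⋯ ∧ eₙ`. -/
noncomputable def wedgePairing (R : Type u) [CommRing R] (n p q : ℕ) :
    ⋀[R]^q (Fin n → R) →ₗ[R] Dual R (⋀[R]^p (Fin n → R)) :=
  (((LinearMap.mul R (ExteriorAlgebra R (Fin n → R))).compr₂
    ((Pi.basisFun R (Fin n)).ExteriorAlgebra.coord Finset.univ)).domRestrict₁₂
      (⋀[R]^p (Fin n → R)) (⋀[R]^q (Fin n → R))).flip

theorem wedgePairing_apply {p q : ℕ} (z : ⋀[R]^q (Fin n → R)) (x : ⋀[R]^p (Fin n → R)) :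
    wedgePairing R n p q z x =
      (Pi.basisFun R (Fin n)).ExteriorAlgebra.coord Finset.univ (x.1 * z.1) :=
  rfl

theorem wedgePairing_basis_self {p q : ℕ} (h : p + q = n) (s : Set.powersetCard (Fin n) p)
    (t : Set.powersetCard (Fin n) q) (hst : Disjoint s.1 t.1) :
    ∃ ε : ℤˣ, wedgePairing R n p q ((Pi.basisFun R (Fin n)).exteriorPower q t)
      ((Pi.basisFun R (Fin n)).exteriorPower p s) = ((ε : ℤ) : R) := by
  refine ⟨(Set.powersetCard.permOfDisjoint hst).sign, ?_⟩
  rw [wedgePairing_apply, ← basis_eq_coe_basis, ← basis_eq_coe_basis, basis_mul_of_disjoint _ _ _ hst]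
  have : (Set.powersetCard.disjUnion hst).1 = (Finset.univ : Finset (Fin n)) := by
    rw [← Finset.card_eq_iff_eq_univ, Set.powersetCard.card_eq, Fintype.card_fin, h]
  rw [this, Units.smul_def, map_zsmul, Basis.coord_apply, Basis.repr_self,
    Finsupp.single_eq_same, zsmul_one]

theorem wedgePairing_basis_of_not_disjoint {p q : ℕ} (s : Set.powersetCard (Fin n) p)
    (t : Set.powersetCard (Fin n) q) (hst : ¬ Disjoint s.1 t.1) :
    wedgePairing R n p q ((Pi.basisFun R (Fin n)).exteriorPower q t)
      ((Pi.basisFun R (Fin n)).exteriorPower p s) = 0 := by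
  rw [wedgePairing_apply, ← basis_eq_coe_basis, ← basis_eq_coe_basis,
    basis_mul_of_not_disjoint _ _ _ hst, map_zero]

theorem disjoint_iff_eq_compl {p q : ℕ} (h : p + q = n) (s : Set.powersetCard (Fin n) p)
    (t : Set.powersetCard (Fin n) q) : Disjoint s.1 t.1 ↔ t.1 = s.1ᶜ := by
  constructor
  · intro hst
    refine Finset.eq_of_subset_of_card_le (fun x hx => ?_) ?_
    · simpa using fun hxs => Finset.disjoint_left.1 hst hxs hx
    · rw [Finset.card_compl, Fintype.card_fin, s.2, t.2]
      lia
  · intro hst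
    rw [hst]
    exact disjoint_compl_right

/-- In the standard bases the pairing is a monomial matrix with entries ±1: each basis vector pairs
nontrivially only with the one on the complementary index set. -/
theorem wedgePairing_bijective {p q : ℕ} (h : p + q = n) :
    Function.Bijective (wedgePairing R n p q) := by
  classical
  let b := (Pi.basisFun R (Fin n)).exteriorPower p
  let c := (Pi.basisFun R (Fin n)).exteriorPower q
  let σ : Set.powersetCard (Fin n) p ≃ Set.powersetCard (Fin n) q :=
    Set.powersetCard.compl (by simpa [add_comm] using h)
  have hσ (s : Set.powersetCard (Fin n) p) : (σ s).1 = s.1ᶜ := by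
    ext x
    simp [σ]
  choose ε hε using fun s : Set.powersetCard (Fin n) p =>
    wedgePairing_basis_self (R := R) h s (σ s) ((disjoint_iff_eq_compl h _ _).2 (hσ s))
  have hval (s s' : Set.powersetCard (Fin n) p) :
      wedgePairing R n p q (c (σ s)) (b s') = if s' = s then ((ε s : ℤ) : R) else 0 := by
    split_ifs with hs
    · rw [hs]
      exact hε s
    · refine wedgePairing_basis_of_not_disjoint _ _ fun hd => hs ?_
      rw [disjoint_iff_eq_compl h, hσ, compl_inj_iff] at hd
      exact (Subtype.ext hd).symm
  have hunit (s : Set.powersetCard (Fin n) p) : IsUnit ((ε s : ℤ) : R) :=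
    (Units.map (Int.castRingHom R).toMonoidHom (ε s)).isUnit
  let e : ⋀[R]^q (Fin n → R) ≃ₗ[R] Dual R (⋀[R]^p (Fin n → R)) :=
    c.equiv (b.dualBasis.isUnitSMul (w := fun s => ((ε s : ℤ) : R))
      hunit) σ.symm
  have he : wedgePairing R n p q = e.toLinearMap := by
    refine c.ext fun t => ?_
    obtain ⟨s, rfl⟩ := σ.surjective t
    refine b.ext fun s' => ?_
    rw [hval]
    simp only [e, LinearEquiv.coe_coe, Basis.equiv_apply, Equiv.symm_apply_apply]
    rw [Basis.isUnitSMul_apply]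
    simp [Finsupp.single_apply]
  rw [he]
  exact e.bijective

/-- The product x ∧ z lies in ⋀ⁿ⁺¹ = 0; applying the graded Leibniz rule to it relates ∂x ∧ z and x
∧ ∂z. -/
theorem wedgePairing_koszulD (y : Fin n → R) {p q : ℕ} (h : p + q + 1 = n)
    (z : ⋀[R]^(q + 1) (Fin n → R)) :
    wedgePairing R n (p + 1) q (koszulD y q z) =
      (-1 : R) ^ p • wedgePairing R n p (q + 1) z ∘ₗ koszulD y p := by
  refine LinearMap.ext fun x => ?_
  have h0 : x.1 * z.1 = 0 := by
    have := exteriorPower_subsingleton_of_lt (R := R) (n := n) (p := p + 1 + (q + 1)) (by lia)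
    have hmem : x.1 * z.1 ∈ ⋀[R]^(p + 1 + (q + 1)) (Fin n → R) := by
      rw [ExteriorAlgebra.exteriorPower, pow_add]
      exact Submodule.mul_mem_mul x.2 z.2
    exact congrArg Subtype.val (Subsingleton.elim (⟨_, hmem⟩ : ⋀[R]^(p + 1 + (q + 1)) _) 0)
  have h1 := CliffordAlgebra.contractLeft_mul_of_mem_exteriorPower
    (Fintype.linearCombination R y) (p + 1) x.1 z.1 x.2
  rw [h0, map_zero] at h1
  have h2 : (koszulD y p x).1 * z.1 + (-1 : R) ^ (p + 1) • (x.1 * (koszulD y q z).1) = 0 := h1.symm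
  have h3 : x.1 * (koszulD y q z).1 = (-1 : R) ^ p • ((koszulD y p x).1 * z.1) := by
    rw [eq_neg_of_add_eq_zero_left h2, pow_succ, smul_neg, smul_smul, mul_neg_one, mul_neg,
      neg_smul, neg_neg, ← mul_pow, neg_one_mul, neg_neg, one_pow, one_smul]
  simp only [LinearMap.smul_apply, LinearMap.comp_apply, wedgePairing_apply, h3, map_smul]

end ExteriorDuality

/-! ### Koszul cycles, boundaries and homology -/

section KoszulHomology

open Module KoszulExt Abelian

variable {R : Type u} [CommRing R]

/-- Two surjections with the same kernel have isomorphic targets. -/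
theorem nonempty_linearEquiv_of_surjective {M N P : Type*} [AddCommGroup M] [Module R M]
    [AddCommGroup N] [Module R N] [AddCommGroup P] [Module R P] {f : M →ₗ[R] N} {g : M →ₗ[R] P}
    (hf : Function.Surjective f) (hg : Function.Surjective g) (h : ∀ x, f x = 0 ↔ g x = 0) :
    Nonempty (N ≃ₗ[R] P) :=
  ⟨(f.quotKerEquivOfSurjective hf).symm ≪≫ₗ
    Submodule.quotEquivOfEq f.ker g.ker (SetLike.ext fun x => h x) ≪≫ₗ g.quotKerEquivOfSurjective hg⟩

theorem CategoryTheory.ShortComplex.exists_cycles_surjective {A : Type u} [Ring A]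
    (S : ShortComplex (ModuleCat.{u} A)) :
    ∃ π : LinearMap.ker S.g.hom →ₗ[A] S.homology,
      Function.Surjective π ∧ ∀ z, π z = 0 ↔ ∃ w, S.f w = z.1 := by
  let e := S.moduleCatHomologyIso.toLinearEquiv
  refine ⟨e.symm.toLinearMap ∘ₗ (LinearMap.range S.moduleCatToCycles).mkQ,
    e.symm.surjective.comp (Submodule.mkQ_surjective _), fun z => ?_⟩
  refine (e.symm.map_eq_zero_iff (x := (LinearMap.range S.moduleCatToCycles).mkQ z)).trans ?_
  refine (Submodule.Quotient.mk_eq_zero _).trans (LinearMap.mem_range.trans ?_)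
  exact exists_congr fun w => Subtype.ext_iff

theorem ChainComplex.exists_cycles_surjective {A : Type u} [Ring A]
    (K : ChainComplex (ModuleCat.{u} A) ℕ) (m : ℕ) :
    ∃ π : LinearMap.ker (K.d m ((ComplexShape.down ℕ).next m)).hom →ₗ[A] K.homology m,
      Function.Surjective π ∧ ∀ z, π z = 0 ↔ ∃ w, K.d (m + 1) m w = z.1 := by
  obtain ⟨π, hπ, hker⟩ := (K.sc m).exists_cycles_surjective
  refine ⟨π, hπ, fun z => (hker z).trans ?_⟩
  have hprev (k : ℕ) (hk : k = m + 1) :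
      (∃ w, K.d k m w = z.1) ↔ ∃ w, K.d (m + 1) m w = z.1 := by
    subst hk
    rfl
  exact hprev _ (ChainComplex.prev ℕ m)

variable {n : ℕ} (y : Fin n → R)

theorem koszulComplex_d_apply (p : ℕ) (x : ⋀[R]^(p + 1) (Fin n → R)) :
    (koszulComplex y).d (p + 1) p x = koszulD y p x := by
  have h : (koszulComplex y).d (p + 1) p = ModuleCat.ofHom (koszulD y p) :=
    ChainComplex.of_d (fun p => ModuleCat.of R (⋀[R]^p (Fin n → R)))
      (fun p => ModuleCat.ofHom (koszulD y p)) p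
  exact congrArg (fun φ => φ.hom x) h

theorem koszulComplex_d_next_succ_apply (p : ℕ) (x : ⋀[R]^(p + 1) (Fin n → R)) :
    (koszulComplex y).d (p + 1) ((ComplexShape.down ℕ).next (p + 1)) x = 0 ↔
      koszulD y p x = 0 := by
  rw [← koszulComplex_d_apply]
  have (k : ℕ) (hk : k = p) :
      (koszulComplex y).d (p + 1) k x = 0 ↔ (koszulComplex y).d (p + 1) p x = 0 := by
    subst hk
    rfl
  exact this _ (ChainComplex.next_nat_succ p)

/-- Wedging with e_i is a null-homotopy of multiplication by y_i: a cycle z satisfies ∂(e_i ∧ z) =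
y_i z. -/
theorem span_range_le_annihilator_koszulHomology (p : ℕ) :
    Ideal.span (Set.range y) ≤ Module.annihilator R ((koszulComplex y).homology (p + 1)) := by
  obtain ⟨π, hπ, hker⟩ := (koszulComplex y).exists_cycles_surjective (p + 1)
  rw [Ideal.span_le]
  rintro _ ⟨i, rfl⟩
  refine Module.mem_annihilator.2 fun h => ?_
  obtain ⟨z, rfl⟩ := hπ h
  rw [← map_smul, hker]
  have hz : koszulD y p z.1 = 0 := (koszulComplex_d_next_succ_apply y p z.1).1 z.2
  let b : ⋀[R]^(p + 1) (Fin n → R) := z.1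
  have hmem : ExteriorAlgebra.ι R (Pi.single i (1 : R)) * b.1 ∈ ⋀[R]^(p + 2) (Fin n → R) := by
    rw [ExteriorAlgebra.exteriorPower, pow_succ']
    exact Submodule.mul_mem_mul ⟨_, rfl⟩ b.2
  refine ⟨⟨_, hmem⟩, (koszulComplex_d_apply y (p + 1) _).trans (Subtype.ext ?_)⟩
  refine (CliffordAlgebra.contractLeft_ι_mul (Q := (0 : QuadraticForm R (Fin n → R)))
    (Fintype.linearCombination R y) (Pi.single i (1 : R)) b.1).trans ?_
  have hb : CliffordAlgebra.contractLeft (Q := (0 : QuadraticForm R (Fin n → R)))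
    (Fintype.linearCombination R y) b.1 = 0 := congrArg Subtype.val hz
  rw [hb, mul_zero, sub_zero, Fintype.linearCombination_apply_single, one_smul]
  rfl

theorem nonempty_quotient_equiv_opcycles_zero :
    Nonempty ((R ⧸ Ideal.span (Set.range y)) ≃ₗ[R] (koszulComplex y).opcycles 0) := by
  let ρ : R →ₗ[R] ⋀[R]^0 (Fin n → R) :=
    (Algebra.linearMap R (ExteriorAlgebra R (Fin n → R))).codRestrict _ fun r => by
      rw [ExteriorAlgebra.exteriorPower, pow_zero]
      exact Submodule.algebraMap_mem r
  have hρ : Function.Surjective ρ := by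
    rintro ⟨x, hx⟩
    have hx' := hx
    rw [ExteriorAlgebra.exteriorPower, pow_zero] at hx'
    obtain ⟨r, rfl⟩ := Submodule.mem_one.1 hx'
    exact ⟨r, rfl⟩
  have hdρ (v : Fin n → R) (hv : ExteriorAlgebra.ι R v ∈ ⋀[R]^1 (Fin n → R)) :
      koszulD y 0 ⟨_, hv⟩ = ρ (Fintype.linearCombination R y v) :=
    Subtype.ext (CliffordAlgebra.contractLeft_ι (0 : QuadraticForm R (Fin n → R)) _ v)
  have hmem (v : Fin n → R) : ExteriorAlgebra.ι R v ∈ ⋀[R]^1 (Fin n → R) := by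
    rw [ExteriorAlgebra.exteriorPower, pow_one]
    exact ⟨v, rfl⟩
  have hp : Function.Surjective ((koszulComplex y).pOpcycles 0) :=
    (ModuleCat.epi_iff_surjective _).1 inferInstance
  refine nonempty_linearEquiv_of_surjective (Submodule.mkQ_surjective _)
    (g := ((koszulComplex y).pOpcycles 0).hom ∘ₗ ρ) (hp.comp hρ) fun r => ?_
  have hprev (k : ℕ) (hk : k = 1) : (∃ w, (koszulComplex y).d k 0 w = ρ r) ↔
      ∃ w, (koszulComplex y).d 1 0 w = ρ r := by
    subst hk
    rfl
  rw [Submodule.mkQ_apply, Submodule.Quotient.mk_eq_zero]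
  refine Iff.trans ?_ (((koszulComplex y).sc 0).moduleCat_pOpcycles_eq_zero_iff (ρ r)).symm
  refine Iff.trans ?_ (hprev _ (ChainComplex.prev ℕ 0)).symm
  rw [← Ideal.submodule_span_eq, ← Fintype.range_linearCombination, LinearMap.mem_range]
  constructor
  · rintro ⟨v, rfl⟩
    exact ⟨⟨_, hmem v⟩, (koszulComplex_d_apply y 0 _).trans (hdρ v _)⟩
  · rintro ⟨⟨w, hw⟩, hwr⟩
    have hw' := hw
    rw [ExteriorAlgebra.exteriorPower, pow_one] at hw'
    obtain ⟨v, rfl⟩ := hw'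
    refine ⟨v, ?_⟩
    have := ((hdρ v hw).symm.trans (koszulComplex_d_apply y 0 _).symm).trans hwr
    exact (ExteriorAlgebra.algebraMap_inj _ _ _).1 (congrArg Subtype.val this)

theorem koszulComplex_mem_cycles_iff {g m : ℕ} (h : g + 1 + m = n)
    (z : ⋀[R]^m (Fin n → R)) :
    (koszulComplex y).d m ((ComplexShape.down ℕ).next m) z = 0 ↔
      wedgePairing R n (g + 1) m z ∘ₗ koszulD y (g + 1) = 0 := by
  cases m with
  | zero =>
    -- Here n = g + 1, and both conditions are automatic: nothing leaves degree 0, and ⋀^{g+2} = 0.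
    have := exteriorPower_subsingleton_of_lt (R := R) (n := n) (p := g + 1 + 1) (by lia)
    refine iff_of_true ?_ (LinearMap.ext fun x => by rw [Subsingleton.elim x 0, map_zero, map_zero])
    rw [(koszulComplex y).shape _ _ (by simp)]
    rfl
  | succ k =>
    rw [koszulComplex_d_next_succ_apply,
      ← (injective_iff_map_eq_zero' _).1 (wedgePairing_bijective (R := R) (n := n)
        (p := g + 1 + 1) (q := k) (by lia)).1,
      wedgePairing_koszulD y (by lia)]
    exact ((isUnit_neg_one (α := R)).pow _).smul_eq_zero

theorem koszulComplex_mem_boundaries_iff {g m : ℕ} (h : g + 1 + m = n)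
    (z : ⋀[R]^m (Fin n → R)) :
    (∃ w, (koszulComplex y).d (m + 1) m w = z) ↔
      ∃ φ : Dual R (⋀[R]^g (Fin n → R)), φ ∘ₗ koszulD y g = wedgePairing R n (g + 1) m z := by
  have hsurj := (wedgePairing_bijective (R := R) (n := n) (p := g) (q := m + 1) (by lia)).2
  have hinj := (wedgePairing_bijective (R := R) (n := n) (p := g + 1) (q := m) h).1
  constructor
  · rintro ⟨w, rfl⟩
    refine ⟨(-1 : R) ^ g • wedgePairing R n g (m + 1) w, ?_⟩
    refine Eq.trans ?_ (congrArg _ (koszulComplex_d_apply y m w).symm)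
    exact (wedgePairing_koszulD y (p := g) (by lia) w).symm
  · rintro ⟨φ, hφ⟩
    -- The sign cancels the one produced by `wedgePairing_koszulD`.
    obtain ⟨w, hw⟩ := hsurj ((-1 : R) ^ g • φ)
    refine ⟨w, (koszulComplex_d_apply y m w).trans (hinj ?_)⟩
    rw [wedgePairing_koszulD y (by lia), ← hφ, hw, LinearMap.smul_comp, smul_smul, ← mul_pow,
      neg_one_mul, neg_neg, one_pow, one_smul]

end KoszulHomology

/-! ### Assembling the isomorphism -/

section Main

open Module KoszulExt Abelian

variable {R : Type u} [CommRing R]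

/-- Degree zero extension classes on `K.opcycles i`, seen as linear maps on `K.X i`. -/
noncomputable def extOpcyclesToDual (K : ChainComplex (ModuleCat.{u} R) ℕ) (i : ℕ) :
    Ext.{u} (K.opcycles i) (ModuleCat.of R R) 0 →ₗ[R] Dual R (K.X i) :=
  (ModuleCat.homLinearEquiv (S := R)).toLinearMap ∘ₗ
    Linear.leftComp R (ModuleCat.of R R) (K.pOpcycles i) ∘ₗ
    (Ext.linearEquiv₀ (R := R)).toLinearMap

theorem extOpcyclesToDual_mk₀ (K : ChainComplex (ModuleCat.{u} R) ℕ) (i : ℕ)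
    (ξ : K.opcycles i ⟶ ModuleCat.of R R) :
    extOpcyclesToDual K i (Ext.mk₀ ξ) = (K.pOpcycles i ≫ ξ).hom := by
  have : Ext.linearEquiv₀ (R := R) (Ext.mk₀ ξ) = ξ :=
    (Ext.linearEquiv₀ (R := R)).apply_symm_apply ξ
  change (K.pOpcycles i ≫ Ext.linearEquiv₀ (R := R) (Ext.mk₀ ξ)).hom = _
  rw [this]

theorem extOpcyclesToDual_injective (K : ChainComplex (ModuleCat.{u} R) ℕ) (i : ℕ) :
    Function.Injective (extOpcyclesToDual K i) := by
  intro a b hab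
  obtain ⟨ξ, rfl⟩ := (Ext.mk₀_bijective _ _).2 a
  obtain ⟨ζ, rfl⟩ := (Ext.mk₀_bijective _ _).2 b
  rw [extOpcyclesToDual_mk₀, extOpcyclesToDual_mk₀] at hab
  rw [(cancel_epi (K.pOpcycles i)).1 (ModuleCat.hom_ext hab)]

/-- A functional on K_i descends to K_i/B_i exactly when it kills the boundaries; these are the
cocycles of the dual complex. -/
theorem mem_range_extOpcyclesToDual_iff (K : ChainComplex (ModuleCat.{u} R) ℕ) (i : ℕ)
    (φ : Dual R (K.X i)) :
    (∃ x, extOpcyclesToDual K i x = φ) ↔ φ ∘ₗ (K.d (i + 1) i).hom = 0 := by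
  constructor
  · rintro ⟨x, rfl⟩
    obtain ⟨ξ, rfl⟩ := (Ext.mk₀_bijective _ _).2 x
    rw [extOpcyclesToDual_mk₀]
    have : K.d (i + 1) i ≫ K.pOpcycles i ≫ ξ = 0 := by simp
    exact congrArg ModuleCat.Hom.hom this
  · intro h
    refine ⟨Ext.mk₀ (K.descOpcycles (ModuleCat.ofHom φ) (i + 1) (ChainComplex.prev ℕ i)
      (ModuleCat.hom_ext h)), ?_⟩
    rw [extOpcyclesToDual_mk₀, HomologicalComplex.p_descOpcycles]
    rfl

theorem exists_fromOpcycles_comp_iff (K : ChainComplex (ModuleCat.{u} R) ℕ) (i : ℕ)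
    (x : Ext.{u} (K.opcycles (i + 1)) (ModuleCat.of R R) 0) :
    (∃ z : Ext.{u} (K.X i) (ModuleCat.of R R) 0,
      (Ext.mk₀ (K.fromOpcycles (i + 1) i)).comp z (zero_add 0) = x) ↔
    ∃ φ : Dual R (K.X i), φ ∘ₗ (K.d (i + 1) i).hom = extOpcyclesToDual K (i + 1) x := by
  obtain ⟨ξ, rfl⟩ := (Ext.mk₀_bijective _ _).2 x
  rw [extOpcyclesToDual_mk₀]
  constructor
  · rintro ⟨z, hz⟩
    obtain ⟨ζ, rfl⟩ := (Ext.mk₀_bijective _ _).2 z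
    rw [Ext.mk₀_comp_mk₀] at hz
    rw [← (Ext.mk₀_bijective _ _).1 hz, HomologicalComplex.p_fromOpcycles_assoc]
    exact ⟨ζ.hom, rfl⟩
  · rintro ⟨φ, hφ⟩
    refine ⟨Ext.mk₀ (ModuleCat.ofHom φ), ?_⟩
    rw [Ext.mk₀_comp_mk₀]
    refine congrArg Ext.mk₀ ((cancel_epi (K.pOpcycles (i + 1))).1 (ModuleCat.hom_ext ?_))
    rw [HomologicalComplex.p_fromOpcycles_assoc, ← hφ]
    rfl

theorem subsingleton_ext_koszulComplex_X {n : ℕ} (y : Fin n → R) (Y : ModuleCat.{u} R) (i j : ℕ) :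
    Subsingleton (Ext.{u} ((koszulComplex y).X i) Y (j + 1)) := by
  have : Projective ((koszulComplex y).X i) :=
    (IsProjective.iff_projective (⋀[R]^i (Fin n → R))).1 inferInstance
  exact HasProjectiveDimensionLT.subsingleton.{u} _ 1 (j + 1) (by lia) _

/-- A consequence of the duality of the Koszul complex: `H_{n-g-1}(y) ≅ Ext^g(H_1(y), R)`, provided
that `Ext^p(H_q(y), R)` vanishes for `p < g` and that `Ext^p(R/(y), R)` vanishes for
`p = g + 1, g + 2`. -/
theorem nonempty_koszulHomology_equiv_ext {n : ℕ} (y : Fin n → R) (g : ℕ)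
    (hH : ∀ i p, p < g →
      Subsingleton (Ext.{u} ((koszulComplex y).homology (i + 1)) (ModuleCat.of R R) p))
    (h₁ : ExtVanishes (R ⧸ Ideal.span (Set.range y)) (ModuleCat.of R R) (g + 1))
    (h₂ : ExtVanishes (R ⧸ Ideal.span (Set.range y)) (ModuleCat.of R R) (g + 2)) :
    Nonempty (koszulHomology y ((n : ℤ) - (g : ℤ) - 1) ≃ₗ[R]
      Ext.{u} (koszulHomology y 1) (ModuleCat.of R R) g) := by
  obtain ⟨e⟩ := nonempty_quotient_equiv_opcycles_zero y
  obtain ⟨θ, hθ, hker⟩ := ChainComplex.exists_surjective_to_ext_homology R (ModuleCat.of R R) g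
    (subsingleton_ext_koszulComplex_X y _) hH (e.extVanishes h₁) (e.extVanishes h₂)
  change Nonempty (_ ≃ₗ[R] Ext.{u} ((koszulComplex y).homology 1) (ModuleCat.of R R) g)
  by_cases hn : g + 1 ≤ n
  · obtain ⟨m, hm⟩ := Nat.exists_eq_add_of_le hn
    rw [show (n : ℤ) - g - 1 = Int.ofNat m by simp; lia]
    change Nonempty ((koszulComplex y).homology m ≃ₗ[R] _)
    obtain ⟨π, hπ, hπker⟩ := (koszulComplex y).exists_cycles_surjective m
    let Φ : (koszulComplex y).X m ≃ₗ[R] Dual R ((koszulComplex y).X (g + 1)) :=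
      LinearEquiv.ofBijective _ (wedgePairing_bijective hm.symm)
    -- κ carries Hom(K_{g+1}/B_{g+1}, R) onto the Koszul cycles in degree m = n - g - 1. The
    -- projection to homology and θ then become two surjections from one module with the same
    -- kernel.
    let κ := Φ.symm.toLinearMap ∘ₗ extOpcyclesToDual (koszulComplex y) (g + 1)
    have hκ : Function.Injective κ :=
      Φ.symm.injective.comp (extOpcyclesToDual_injective (koszulComplex y) (g + 1))
    have hd (p : ℕ) : ((koszulComplex y).d (p + 1) p).hom = koszulD y p :=
      LinearMap.ext (koszulComplex_d_apply y p)
    have hrange : LinearMap.range κ =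
        LinearMap.ker ((koszulComplex y).d m ((ComplexShape.down ℕ).next m)).hom := by
      ext z
      refine Iff.trans ?_ (koszulComplex_mem_cycles_iff y hm.symm z).symm
      rw [← hd]
      refine Iff.trans ?_ (mem_range_extOpcyclesToDual_iff (koszulComplex y) (g + 1) (Φ z))
      exact exists_congr fun x => Φ.symm_apply_eq
    let ε := LinearEquiv.ofInjective κ hκ ≪≫ₗ LinearEquiv.ofEq _ _ hrange
    refine nonempty_linearEquiv_of_surjective (f := π ∘ₗ ε.toLinearMap) (g := θ)
      (hπ.comp ε.surjective) hθ fun x => ?_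
    rw [hker, exists_fromOpcycles_comp_iff]
    refine (hπker (ε x)).trans ((koszulComplex_mem_boundaries_iff y hm.symm (κ x)).trans ?_)
    have hx : wedgePairing R n (g + 1) m (κ x) = extOpcyclesToDual (koszulComplex y) (g + 1) x :=
      Φ.apply_symm_apply _
    rw [hx, ← hd]
    rfl
  -- For n ≤ g the homological index is negative, so the left side is zero; since ⋀^{g+1} = 0 the
  -- source of θ is zero too, and hence so is its target.
  · have hsub : Subsingleton ((koszulComplex y).X (g + 1)) :=
      exteriorPower_subsingleton_of_lt (by lia)
    have hdual : Subsingleton (Dual R ((koszulComplex y).X (g + 1))) :=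
      ⟨fun a b => LinearMap.ext fun x => by rw [Subsingleton.elim x 0, map_zero, map_zero]⟩
    have := (extOpcyclesToDual_injective (koszulComplex y) (g + 1)).subsingleton
    have := hθ.subsingleton
    obtain ⟨k, hk⟩ := Int.eq_negSucc_of_lt_zero (show (n : ℤ) - g - 1 < 0 by lia)
    rw [hk]
    exact ⟨(0 : PUnit.{u + 1} ≃ₗ[R]
      Ext.{u} ((koszulComplex y).homology 1) (ModuleCat.of R R) g)⟩

end Main

theorem theorem1p3 {R : Type u} [CommRing R] (hR : KoszulExt.IsGorensteinLocalRing R)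
    (I : Ideal R) (hI : KoszulExt.IsCohenMacaulayIdeal I)
    (g : ℕ) (hg : KoszulExt.grade I = g)
    (n : ℕ) (y : Fin n → R) (hy : Ideal.span (Set.range y) = I) :
    Nonempty (KoszulExt.koszulHomology y ((n : ℤ) - (g : ℤ) - 1) ≃ₗ[R]
      Abelian.Ext.{u} (KoszulExt.koszulHomology y 1) (ModuleCat.of R R) g) := by
  subst hy
  have := hR.isLocalRing
  have := hR.isNoetherianRing
  have := hI.isLocalRing
  have hIm : Ideal.span (Set.range y) ≤ IsLocalRing.maximalIdeal R :=
    IsLocalRing.le_maximalIdeal (Ideal.Quotient.nontrivial_iff.1 inferInstance)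
  exact nonempty_koszulHomology_equiv_ext y g
    (fun i p hp => subsingleton_ext_of_lt_grade hIm hg _
      (span_range_le_annihilator_koszulHomology y i) hp)
    (extVanishes_quotient_of_grade_lt hR hI hg (by lia))
    (extVanishes_quotient_of_grade_lt hR hI hg (by lia))
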